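/- Let $d\ge 1$ and $\alpha\in(1/2,1)$. For $D>0$ let $\mathcal S(D,\alpha)$ be the set of functions $\theta:[0,\infty)\times\mathbb R^d\to\mathbb R$, smooth on $(0,\infty)\times\mathbb R^d$ and continuous on $[0,\infty)\times\mathbb R^d$, that satisfy $$\partial_t\theta+u\cdot\nabla\theta+(-\Delta)^\alpha\theta=0$$ pointwise on $(0,\infty)\times\mathbb R^d$ (the singular integral defining $(-\Delta)^\alpha\theta$ being convergent there) for some vector field $u$, smooth on $(0,\infty)\times\mathbb R^d$ and divergence free in $x$, with $\|u\|_{L^q((0,\infty);\mathrm{BMO}^{-\gamma}(\mathbb R^d;\mathbb R^d))}\le D$ for some $\gamma>0$, $q\in[1,\infty]$ with $\frac{2\alpha}{q}+\gamma=2\alpha-1$. Here $v\in \mathrm{BMO}^{-\gamma}$ means $v=(-\Delta)^{\gamma/2}\psi$ componentwise in the sense of distributions for some $\psi\in\mathrm{BMO}(\mathbb R^d;\mathbb R^d)$, and $\|v\|_{\mathrm{BMO}^{-\gamma}}=\|\psi\|_{\mathrm{BMO}}$ ($\psi$ being unique up to additive constants). Then there is a constant $C=C(d,\alpha)>0$,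 independent of $D$, with the following property. Let $D>0$ and let $\theta\in\mathcal S(D,\alpha)$ have initial value $\theta_0=\theta(0,\cdot)\in L^2(\mathbb R^d)$. Assume, qualitatively, that the datum is attained in $L^2$, i.e. $\|\theta(t)-\theta_0\|_{L^2(\mathbb R^d)}\to0$ as $t\downarrow0$, and that $\theta(t,x)\to0$ as $|x|\to\infty$, uniformly for $t$ in compact subintervals of $(0,\infty)$. Then for every $t>0$, $$\|\theta\|_{L^\infty([t,\infty)\times\mathbb R^d)}\le C\,\|\theta_0\|_{L^2(\mathbb R^d)}\,t^{-\frac{d}{4\alpha}} .$$ -/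

import Mathlib

open MeasureTheory Set Filter Topology
open scoped ENNReal ContDiff

noncomputable section

namespace DriftDiffusion

/-- Euclidean space `ℝ^d`. -/
abbrev E (d : ℕ) : Type := EuclideanSpace ℝ (Fin d)

/-- The normalizing constant of the singular integral for `(-Δ)^s`, `0 < s < 1`, on `ℝ^d`
(the one for which `(-Δ)^s` has Fourier symbol `|ξ|^(2s)`). -/
def fracLapConst (d : ℕ) (s : ℝ) : ℝ :=
  s * 4 ^ s * Real.Gamma (d / 2 + s) / (Real.pi ^ ((d : ℝ) / 2) * Real.Gamma (1 - s))

/-- The second-difference integrand of the fractional Laplacian `(-Δ)^s f` at the point `x`. -/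
def fracLapIntegrand {d : ℕ} (s : ℝ) (f : E d → ℝ) (x y : E d) : ℝ :=
  (2 * f x - f (x + y) - f (x - y)) / ‖y‖ ^ ((d : ℝ) + 2 * s)

/-- The pointwise fractional Laplacian `(-Δ)^s f (x)`, `0 < s < 1`, i.e.
`(c_{d,s} / 2) ∫ (2 f(x) - f(x+y) - f(x-y)) / |y|^(d+2s) dy`, which is the symmetrized form of
the principal value of `c_{d,s} ∫ (f(x) - f(y)) / |x-y|^(d+2s) dy`.
It is meaningful where `fracLapIntegrand s f x` is integrable. -/
def fracLap {d : ℕ} (s : ℝ) (f : E d → ℝ) (x : E d) : ℝ :=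
  fracLapConst d s / 2 * ∫ y, fracLapIntegrand s f x y

/-- The `BMO` seminorm of a vector field: the supremum over all balls of its mean oscillation. -/
def bmoNorm {d : ℕ} (ψ : E d → E d) : ℝ≥0∞ :=
  ⨆ (x : E d) (r : ℝ) (_ : 0 < r),
    ⨍⁻ y in Metric.ball x r, ‖ψ y - ⨍ z in Metric.ball x r, ψ z ∂volume‖ₑ ∂volume

/-- `ψ ∈ BMO(ℝ^d; ℝ^d)`. -/
def MemBMO {d : ℕ} (ψ : E d → E d) : Prop :=
  LocallyIntegrable ψ ∧ bmoNorm ψ < ⊤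

/-- `v = (-Δ)^(γ/2) ψ` componentwise in the sense of distributions. -/
def IsFracPotential {d : ℕ} (γ : ℝ) (ψ v : E d → E d) : Prop :=
  ∀ φ : E d → ℝ, ContDiff ℝ ∞ φ → HasCompactSupport φ → ∀ i : Fin d,
    ∫ x, v x i * φ x = ∫ x, ψ x i * fracLap (γ / 2) φ x

/-- The norm of `v` in `BMO^{-γ}(ℝ^d; ℝ^d)`, that is `‖ψ‖_BMO` where `ψ ∈ BMO` and
`v = (-Δ)^(γ/2) ψ`. Such a `ψ` is unique up to additive constants, so that the infimum is over a
single value; it is `∞` if there is no such `ψ`, i.e. if `v ∉ BMO^{-γ}`. -/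
def negBMONorm {d : ℕ} (γ : ℝ) (v : E d → E d) : ℝ≥0∞ :=
  ⨅ (ψ : E d → E d) (_ : MemBMO ψ ∧ IsFracPotential γ ψ v), bmoNorm ψ

/-- `u ∈ L^q(ℝ₊; BMO^{-γ}(ℝ^d; ℝ^d))` with norm at most `D`. -/
def DriftBound {d : ℕ} (q : ℝ≥0∞) (γ D : ℝ) (u : ℝ → E d → E d) : Prop :=
  AEMeasurable (fun t => negBMONorm γ (u t)) (volume.restrict (Ioi 0)) ∧
    eLpNorm (fun t => negBMONorm γ (u t)) q (volume.restrict (Ioi 0)) ≤ ENNReal.ofReal D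

/-- `div u(t, ·) = 0` for all times `t > 0`. -/
def DivFree {d : ℕ} (u : ℝ → E d → E d) : Prop :=
  ∀ t : ℝ, 0 < t → ∀ x : E d,
    ∑ i : Fin d, (fderiv ℝ (u t) x (EuclideanSpace.single i 1)) i = 0

/-- `∂_t θ + u · ∇θ + (-Δ)^α θ = 0` holds pointwise on `(0, ∞) × ℝ^d`; in particular the integral
that defines `(-Δ)^α θ` converges there. -/
def SolvesDriftDiffusion {d : ℕ} (α : ℝ) (u : ℝ → E d → E d) (θ : ℝ → E d → ℝ) : Prop :=
  ∀ t : ℝ, 0 < t → ∀ x : E d,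
    Integrable (fracLapIntegrand α (θ t) x) ∧
      deriv (fun s => θ s x) t + inner ℝ (u t x) (gradient (θ t) x) + fracLap α (θ t) x = 0

/-- The set `S(D, α)` of smooth solutions, continuous up to `t = 0`, of the drift-diffusion
equation that are driven by a smooth divergence free drift `u` whose norm in some critical space
`L^q(ℝ₊; BMO^{-γ})`, `2α/q + γ = 2α - 1`, is at most `D`.
Only the values `θ t x` with `t ≥ 0` matter. -/
def solutionSet (d : ℕ) (D α : ℝ) : Set (ℝ → E d → ℝ) :=
  {θ | ContDiffOn ℝ ∞ (Function.uncurry θ) (Ioi 0 ×ˢ univ) ∧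
    ContinuousOn (Function.uncurry θ) (Ici 0 ×ˢ univ) ∧
    ∃ (u : ℝ → E d → E d) (q : ℝ≥0∞) (γ : ℝ),
      ContDiffOn ℝ ∞ (Function.uncurry u) (Ioi 0 ×ˢ univ) ∧
      DivFree u ∧
      1 ≤ q ∧ 0 < γ ∧ 2 * α * (q⁻¹).toReal + γ = 2 * α - 1 ∧
      DriftBound q γ D u ∧
      SolvesDriftDiffusion α u θ}

/-- `θ(t) → θ(0)` in `L²(ℝ^d)` as `t ↓ 0`. -/
def AttainsDatumInL2 {d : ℕ} (θ : ℝ → E d → ℝ) : Prop :=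
  Tendsto (fun t => eLpNorm (fun x => θ t x - θ 0 x) 2 volume) (𝓝[>] 0) (𝓝 0)

/-- `θ(t, x) → 0` as `|x| → ∞`, uniformly for `t` in compact subintervals of `(0, ∞)`. -/
def VanishesAtInfinity {d : ℕ} (θ : ℝ → E d → ℝ) : Prop :=
  ∀ s T ε : ℝ, 0 < s → s ≤ T → 0 < ε →
    ∃ R : ℝ, ∀ t ∈ Icc s T, ∀ x : E d, R ≤ ‖x‖ → |θ t x| ≤ ε

end DriftDiffusion

end

/-! The proof combines a Chebyshev bound with a nonlinear maximum principle. The drift enters only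
through two identities that do not see its size, so C does not depend on D: a divergence-free field
contributes nothing to the evolution of `∫ Φ(θ)`, and `u · ∇θ` vanishes at a spatial maximum.

If Φ is smooth, convex and zero below some k > 0, then Φ(θ) has compact support in x. The
Córdoba–Córdoba inequality makes the diffusion term dissipative, and `∫ Φ(θ)` decreases
(`antitoneOn_integral_comp`). With k = M/4 and ‖θ(s)‖₂ ≤ A this bounds the volume of {θ(t) > M/2} by
a multiple of (A/M)² for t ≥ s (`volume_superlevel_le`).

If M > 0 is the spatial maximum of θ(t), a small superlevel set forces (-Δ)^α θ at the maximum point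
to be at least c M (M/A)^(4α/d) (`exists_le_fracLap_of_isMax`). Put β = d/(4α) and maximize θ (t -
s)^β over a time slab. At a positive maximum the time derivative gives (-Δ)^α θ ≤ β M / (t - s),
hence M ≤ C A (t - s)^(-β). Applying this to θ and -θ, then letting s ↓ 0 and A ↓ ‖θ₀‖₂, finishes
the proof. -/

namespace DriftDiffusion

/-! ### A smooth convex function vanishing on the negative half line -/

/-- The smooth convex function `s ↦ s * exp (-1 / s)`, extended by zero to `s ≤ 0`. -/
noncomputable def convexCutoff (s : ℝ) : ℝ := s * expNegInvGlue s

theorem contDiff_convexCutoff : ContDiff ℝ ∞ convexCutoff :=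
  contDiff_id.mul expNegInvGlue.contDiff

theorem convexCutoff_of_nonpos {s : ℝ} (hs : s ≤ 0) : convexCutoff s = 0 := by
  simp [convexCutoff, expNegInvGlue.zero_of_nonpos hs]

theorem convexCutoff_of_pos {s : ℝ} (hs : 0 < s) : convexCutoff s = s * Real.exp (-s⁻¹) := by
  simp [convexCutoff, expNegInvGlue, hs.not_ge]

theorem convexCutoff_nonneg (s : ℝ) : 0 ≤ convexCutoff s := by
  rcases le_or_gt s 0 with hs | hs
  · exact (convexCutoff_of_nonpos hs).ge
  · exact mul_nonneg hs.le (expNegInvGlue.nonneg s)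

/-- Lets the L² norm control the integral of the cutoff at the earlier time; the next bound supplies
the Chebyshev threshold at the later time. -/
theorem convexCutoff_sub_one_le_sq (s : ℝ) : convexCutoff (s - 1) ≤ s ^ 2 := by
  rcases le_or_gt (s - 1) 0 with hs | hs
  · rw [convexCutoff_of_nonpos hs]; positivity
  · rw [convexCutoff_of_pos hs]
    have h1 : Real.exp (-(s - 1)⁻¹) ≤ 1 := Real.exp_le_one_iff.2 (by simpa using hs.le)
    nlinarith

theorem exp_neg_one_le_convexCutoff {s : ℝ} (hs : 1 ≤ s) : Real.exp (-1) ≤ convexCutoff s := by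
  rw [convexCutoff_of_pos (by linarith)]
  have h1 : Real.exp (-1) ≤ Real.exp (-s⁻¹) :=
    Real.exp_le_exp.2 (neg_le_neg (inv_le_one_of_one_le₀ hs))
  nlinarith [Real.exp_pos (-1)]

/-- Convexity in the tangent-line form used by the Córdoba–Córdoba inequality. For positive a and b
it reduces to 1 + x ≤ exp x with x = a⁻¹ - b⁻¹. -/
theorem convexCutoff_tangent_le (a b : ℝ) :
    convexCutoff a + deriv convexCutoff a * (b - a) ≤ convexCutoff b := by
  rcases le_or_gt a 0 with ha | ha
  · have h0 : deriv convexCutoff a = 0 := by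
      apply IsLocalMin.deriv_eq_zero
      refine Eventually.of_forall fun y => ?_
      rw [convexCutoff_of_nonpos ha]
      exact convexCutoff_nonneg y
    rw [h0, convexCutoff_of_nonpos ha]
    simpa using convexCutoff_nonneg b
  · have hd : deriv convexCutoff a = Real.exp (-a⁻¹) * (1 + a⁻¹) := by
      have h1 : HasDerivAt (fun s : ℝ => s * Real.exp (-s⁻¹)) (Real.exp (-a⁻¹) * (1 + a⁻¹)) a := by
        have := (hasDerivAt_id a).mul ((hasDerivAt_inv ha.ne').neg.exp)
        convert! this using 1
        simp only [id, Pi.neg_apply]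
        field_simp
      have h2 : convexCutoff =ᶠ[𝓝 a] fun s : ℝ => s * Real.exp (-s⁻¹) := by
        filter_upwards [lt_mem_nhds ha] with s hs using convexCutoff_of_pos hs
      rw [h2.deriv_eq, h1.deriv]
    rw [hd, convexCutoff_of_pos ha]
    have hea := Real.exp_pos (-a⁻¹)
    have key : a * Real.exp (-a⁻¹) + Real.exp (-a⁻¹) * (1 + a⁻¹) * (b - a) =
        Real.exp (-a⁻¹) * (b + b * a⁻¹ - 1) := by
      field_simp
      ring
    rw [key]
    rcases le_or_gt b 0 with hb | hb
    · rw [convexCutoff_of_nonpos hb]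
      have : b * a⁻¹ ≤ 0 := mul_nonpos_of_nonpos_of_nonneg hb (inv_pos.2 ha).le
      nlinarith
    · rw [convexCutoff_of_pos hb]
      have h1 := Real.add_one_le_exp (a⁻¹ - b⁻¹)
      have h2 : Real.exp (-b⁻¹) = Real.exp (-a⁻¹) * Real.exp (a⁻¹ - b⁻¹) := by
        rw [← Real.exp_add]; congr 1; ring
      have h3 : b + b * a⁻¹ - 1 = b * (a⁻¹ - b⁻¹ + 1) := by
        field_simp
        ring
      rw [h2, h3]
      calc Real.exp (-a⁻¹) * (b * (a⁻¹ - b⁻¹ + 1))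
          ≤ Real.exp (-a⁻¹) * (b * Real.exp (a⁻¹ - b⁻¹)) := by gcongr
        _ = _ := by ring

/-! ### The fractional Laplacian of smooth compactly supported functions -/

theorem fracLapConst_pos {d : ℕ} {s : ℝ} (h0 : 0 < s) (h1 : s < 1) : 0 < fracLapConst d s := by
  unfold fracLapConst
  have := Real.Gamma_pos_of_pos (s := (d : ℝ) / 2 + s) (by positivity)
  have := Real.Gamma_pos_of_pos (s := 1 - s) (by linarith)
  positivity

/-- In polar coordinates the radial integrand is r^(1-2s) near zero, integrable as s < 1, and
r^(-1-2s) at infinity, integrable as s > 0. -/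
theorem integrable_min_sq_div_rpow {d : ℕ} (hd : 1 ≤ d) {s : ℝ} (h0 : 0 < s) (h1 : s < 1) :
    Integrable (fun y : E d => min (‖y‖ ^ 2) 1 / ‖y‖ ^ ((d : ℝ) + 2 * s)) := by
  have : Nontrivial (E d) := Module.nontrivial_of_finrank_pos (R := ℝ) (by simp; omega)
  rw [integrable_fun_norm_addHaar (volume : Measure (E d))
    (f := fun r : ℝ => min (r ^ 2) 1 / r ^ ((d : ℝ) + 2 * s))]
  have hd' : ((d - 1 : ℕ) : ℝ) = d - 1 := by push_cast [hd]; ring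
  rw [← Ioc_union_Ioi_eq_Ioi (zero_le_one (α := ℝ))]
  refine IntegrableOn.union ?_ ?_
  · have : IntegrableOn (fun r : ℝ => r ^ (1 - 2 * s)) (Ioc 0 1) := by
      have := intervalIntegral.intervalIntegrable_rpow' (a := 0) (b := 1)
        (r := 1 - 2 * s) (by linarith)
      rwa [intervalIntegrable_iff_integrableOn_Ioc_of_le zero_le_one] at this
    refine this.congr_fun (fun r hr => ?_) measurableSet_Ioc
    have hr0 : 0 < r := hr.1
    have hmin : min (r ^ 2) 1 = r ^ 2 := min_eq_left (by nlinarith [hr.2])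
    simp only [hmin, smul_eq_mul, finrank_euclideanSpace, Fintype.card_fin]
    rw [← Real.rpow_natCast r 2, ← Real.rpow_natCast r (d - 1), hd', ← Real.rpow_sub hr0,
      ← Real.rpow_add hr0]
    congr 1
    push_cast
    ring
  · have : IntegrableOn (fun r : ℝ => r ^ (-1 - 2 * s)) (Ioi 1) :=
      integrableOn_Ioi_rpow_of_lt (by linarith) one_pos
    refine this.congr_fun (fun r hr => ?_) measurableSet_Ioi
    have hr1 : (1 : ℝ) < r := hr
    have hr0 : 0 < r := by linarith
    have hmin : min (r ^ 2) 1 = 1 := min_eq_right (by nlinarith)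
    simp only [hmin, smul_eq_mul, finrank_euclideanSpace, Fintype.card_fin]
    rw [one_div, ← Real.rpow_natCast r (d - 1), hd', ← Real.rpow_neg hr0.le, ← Real.rpow_add hr0]
    congr 1
    ring

/-- The derivative of t ↦ g(x + ty) + g(x - ty) is at most 2C‖y‖² on [0, 1], where C is a Lipschitz
constant of the derivative of g. -/
theorem exists_second_difference_bound {d : ℕ} {g : E d → ℝ} (hg : ContDiff ℝ 2 g)
    (hc : HasCompactSupport g) :
    ∃ L : ℝ, 0 ≤ L ∧ ∀ x y, |2 * g x - g (x + y) - g (x - y)| ≤ L * ‖y‖ ^ 2 := by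
  obtain ⟨C, hC⟩ := ContDiff.lipschitzWith_of_hasCompactSupport (𝕂 := ℝ) (hc.fderiv ℝ)
    (hg.fderiv_right (m := 1) (by norm_num)) one_ne_zero
  refine ⟨2 * C, by positivity, fun x y => ?_⟩
  have hdiff : Differentiable ℝ g := hg.differentiable (by norm_num)
  have hder : ∀ t : ℝ, HasDerivAt (fun t : ℝ => g (x + t • y) + g (x - t • y))
      (fderiv ℝ g (x + t • y) y - fderiv ℝ g (x - t • y) y) t := by
    intro t
    have hl : HasDerivAt (fun t : ℝ => t • y) y t := by
      simpa using (hasDerivAt_id t).smul_const y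
    have h1 := (hdiff (x + t • y)).hasFDerivAt.comp_hasDerivAt t (hl.const_add x)
    have h2 := (hdiff (x - t • y)).hasFDerivAt.comp_hasDerivAt t (hl.const_sub x)
    convert! h1.add h2 using 1
    simp [sub_eq_add_neg]
  have hb := norm_image_sub_le_of_norm_deriv_le_segment_01' (C := 2 * C * ‖y‖ ^ 2)
    (fun t _ => (hder t).hasDerivWithinAt) (fun t ht => by
      rw [← sub_apply]
      refine (ContinuousLinearMap.le_opNorm _ _).trans ?_
      have h1 := hC.dist_le_mul (x + t • y) (x - t • y)
      rw [dist_eq_norm, dist_eq_norm] at h1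
      have h2 : x + t • y - (x - t • y) = (2 * t) • y := by module
      rw [h2, norm_smul, Real.norm_of_nonneg (by linarith [ht.1])] at h1
      have h3 : (C : ℝ) * (2 * t * ‖y‖) ≤ 2 * C * ‖y‖ := by
        have : (C : ℝ) * ‖y‖ * t ≤ C * ‖y‖ * 1 := by
          gcongr
          exact ht.2.le
        linarith
      calc _ ≤ 2 * C * ‖y‖ * ‖y‖ := by gcongr; exact h1.trans h3
        _ = _ := by ring)
  simp only [one_smul, zero_smul, add_zero, sub_zero] at hb
  rw [← abs_neg]
  rw [Real.norm_eq_abs] at hb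
  convert hb using 2
  ring

/-! ### Integrals of the fractional Laplacian and the convexity inequality -/

section

variable {d : ℕ} {g : E d → ℝ} {s : ℝ}

theorem integrable_second_difference (hg : Integrable g) (y : E d) :
    Integrable (fun x => 2 * g x - g (x + y) - g (x - y)) :=
  ((hg.const_mul 2).sub (hg.comp_add_right y)).sub (hg.comp_sub_right y)

theorem integral_second_difference (hg : Integrable g) (y : E d) :
    ∫ x, (2 * g x - g (x + y) - g (x - y)) = 0 := by
  have h1 : Integrable (fun x => 2 * g x - g (x + y)) :=
    (hg.const_mul 2).sub (hg.comp_add_right y)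
  rw [integral_sub h1 (hg.comp_sub_right y), integral_sub (hg.const_mul 2) (hg.comp_add_right y), integral_const_mul,
    integral_add_right_eq_self g y, integral_sub_right_eq_self g y]
  ring

theorem integral_abs_second_difference_le (hg : Integrable g) (y : E d) :
    ∫ x, |2 * g x - g (x + y) - g (x - y)| ≤ 4 * ∫ x, |g x| := by
  have h1 : Integrable (fun x => 2 * |g x| + |g (x + y)| + |g (x - y)|) :=
    ((hg.abs.const_mul 2).add (hg.abs.comp_add_right y)).add (hg.abs.comp_sub_right y)
  calc _ ≤ ∫ x, (2 * |g x| + |g (x + y)| + |g (x - y)|) := by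
        refine integral_mono (integrable_second_difference hg y).abs h1 fun x => ?_
        calc |2 * g x - g (x + y) - g (x - y)| ≤ |2 * g x - g (x + y)| + |g (x - y)| := abs_sub _ _
          _ ≤ |2 * g x| + |g (x + y)| + |g (x - y)| := by gcongr; exact abs_sub _ _
          _ = _ := by rw [abs_mul]; norm_num
    _ = _ := by
        have h2 : Integrable (fun x => 2 * |g x| + |g (x + y)|) :=
          (hg.abs.const_mul 2).add (hg.abs.comp_add_right y)
        rw [integral_add h2 (hg.abs.comp_sub_right y), integral_add (hg.abs.const_mul 2) (hg.abs.comp_add_right y),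
          integral_const_mul, integral_add_right_eq_self (fun x => |g x|) y,
          integral_sub_right_eq_self (fun x => |g x|) y]
        ring

/-- For ‖y‖ ≤ 1 the second difference is O(‖y‖²) and lives in a fixed ball; for larger y the L¹ norm
of g suffices. -/
theorem exists_integral_abs_second_difference_le (hg : ContDiff ℝ 2 g) (hc : HasCompactSupport g) :
    ∃ C : ℝ, ∀ y, ∫ x, |2 * g x - g (x + y) - g (x - y)| ≤ C * min (‖y‖ ^ 2) 1 := by
  have hi : Integrable g := hg.continuous.integrable_of_hasCompactSupport hc
  obtain ⟨L, hL0, hL⟩ := exists_second_difference_bound hg hc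
  obtain ⟨R, hR⟩ := hc.isCompact.isBounded.subset_closedBall 0
  set V : ℝ := (volume (Metric.closedBall (0 : E d) (R + 1))).toReal
  have hI : 0 ≤ ∫ x, |g x| := integral_nonneg fun x => abs_nonneg _
  have hV : 0 ≤ V := ENNReal.toReal_nonneg
  refine ⟨4 * (∫ x, |g x|) + L * V, fun y => ?_⟩
  rcases le_or_gt ‖y‖ 1 with hy | hy
  · rw [min_eq_left (by nlinarith [norm_nonneg y])]
    have hz : ∀ z : E d, R < ‖z‖ → g z = 0 := fun z hz => image_eq_zero_of_notMem_tsupport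
      fun hz' => absurd hz (not_lt.2 (by simpa using hR hz'))
    have h1 : ∫ x, |2 * g x - g (x + y) - g (x - y)| ≤
        ∫ x, (Metric.closedBall (0 : E d) (R + 1)).indicator (fun _ => L * ‖y‖ ^ 2) x := by
      refine integral_mono (integrable_second_difference hi y).abs
        (integrable_indicator_iff Metric.isClosed_closedBall.measurableSet |>.2
          (integrableOn_const measure_closedBall_lt_top.ne)) fun x => ?_
      by_cases hx : x ∈ Metric.closedBall (0 : E d) (R + 1)
      · simpa [hx] using hL x y
      · rw [indicator_of_notMem hx]
        have hx' : R + 1 < ‖x‖ := by simpa using hx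
        have e1 := norm_sub_le (x + y) y
        have e2 := norm_add_le (x - y) y
        simp only [add_sub_cancel_right, sub_add_cancel] at e1 e2
        simp [hz x (by linarith), hz (x + y) (by linarith), hz (x - y) (by linarith)]
    rw [integral_indicator Metric.isClosed_closedBall.measurableSet, setIntegral_const] at h1
    refine h1.trans ?_
    have : (volume.real (Metric.closedBall (0 : E d) (R + 1))) = V := rfl
    rw [this, smul_eq_mul]
    nlinarith [mul_nonneg hI (sq_nonneg ‖y‖)]
  · rw [min_eq_right (by nlinarith)]
    nlinarith [integral_abs_second_difference_le hi y, mul_nonneg hL0 hV]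

theorem integrable_uncurry_fracLapIntegrand (hd : 1 ≤ d) (h0 : 0 < s) (h1 : s < 1)
    (hg : ContDiff ℝ 2 g) (hc : HasCompactSupport g) :
    Integrable (Function.uncurry (fracLapIntegrand s g))
      ((volume : Measure (E d)).prod (volume : Measure (E d))) := by
  have hi : Integrable g := hg.continuous.integrable_of_hasCompactSupport hc
  have hm : Measurable (Function.uncurry (fracLapIntegrand s g)) := by
    have := hg.continuous.measurable
    unfold fracLapIntegrand Function.uncurry
    fun_prop
  rw [integrable_prod_iff' hm.aestronglyMeasurable]
  refine ⟨Eventually.of_forall fun y => ?_, ?_⟩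
  · exact (integrable_second_difference hi y).div_const (‖y‖ ^ ((d : ℝ) + 2 * s))
  · obtain ⟨C, hC⟩ := exists_integral_abs_second_difference_le hg hc
    refine ((integrable_min_sq_div_rpow hd h0 h1).const_mul C).mono'
      hm.norm.stronglyMeasurable.integral_prod_left'.aestronglyMeasurable
      (Eventually.of_forall fun y => ?_)
    have hy : 0 ≤ ‖y‖ ^ ((d : ℝ) + 2 * s) := by positivity
    rw [Real.norm_of_nonneg (integral_nonneg fun x => norm_nonneg _)]
    have : ∀ x, ‖Function.uncurry (fracLapIntegrand s g) (x, y)‖ =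
        |2 * g x - g (x + y) - g (x - y)| / ‖y‖ ^ ((d : ℝ) + 2 * s) := fun x => by
      rw [Function.uncurry_apply_pair, fracLapIntegrand, norm_div, Real.norm_of_nonneg hy,
        Real.norm_eq_abs]
    simp only [this]
    rw [integral_div, ← mul_div_assoc]
    gcongr
    exact hC y

/-- By Fubini the x-integral can be taken first, and each second difference integrates to zero by
translation invariance. -/
theorem integral_fracLap (hd : 1 ≤ d) (h0 : 0 < s) (h1 : s < 1)
    (hg : ContDiff ℝ 2 g) (hc : HasCompactSupport g) : ∫ x, fracLap s g x = 0 := by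
  have hi : Integrable g := hg.continuous.integrable_of_hasCompactSupport hc
  unfold fracLap
  rw [integral_const_mul, integral_integral_swap
    (integrable_uncurry_fracLapIntegrand hd h0 h1 hg hc)]
  have : ∀ y, ∫ x, fracLapIntegrand s g x y = 0 := fun y => by
    unfold fracLapIntegrand
    rw [integral_div, integral_second_difference hi, zero_div]
  simp [this]

theorem integrable_fracLap (hd : 1 ≤ d) (h0 : 0 < s) (h1 : s < 1)
    (hg : ContDiff ℝ 2 g) (hc : HasCompactSupport g) : Integrable (fracLap s g) :=
  (integrable_uncurry_fracLapIntegrand hd h0 h1 hg hc).integral_prod_left.const_mul _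

/-- The pointwise inequality of Córdoba and Córdoba. -/
theorem fracLap_comp_le {Φ : ℝ → ℝ} {f : E d → ℝ} {x : E d} (h0 : 0 < s) (h1 : s < 1)
    (hΦ : ∀ a b, Φ a + deriv Φ a * (b - a) ≤ Φ b)
    (hf : Integrable (fracLapIntegrand s f x))
    (hΦf : Integrable (fracLapIntegrand s (Φ ∘ f) x)) :
    fracLap s (Φ ∘ f) x ≤ deriv Φ (f x) * fracLap s f x := by
  have hc := fracLapConst_pos (d := d) h0 h1
  unfold fracLap
  rw [mul_left_comm, ← integral_const_mul (deriv Φ (f x))]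
  refine mul_le_mul_of_nonneg_left (integral_mono hΦf (hf.const_mul _) fun y => ?_) (by positivity)
  simp only [fracLapIntegrand]
  rw [← mul_div_assoc]
  gcongr
  have e1 := hΦ (f x) (f (x + y))
  have e2 := hΦ (f x) (f (x - y))
  simp only [Function.comp_apply]
  linarith

/-- If `Φ` is convex and `Φ ∘ f` is compactly supported, then `∫ Φ'(f) (-Δ)^s f ≥ 0`. -/
theorem integral_deriv_mul_fracLap_nonneg (hd : 1 ≤ d) (h0 : 0 < s) (h1 : s < 1)
    {Φ : ℝ → ℝ} {f : E d → ℝ} (hΦ : ∀ a b, Φ a + deriv Φ a * (b - a) ≤ Φ b)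
    (hΦf : ContDiff ℝ 2 (Φ ∘ f)) (hc : HasCompactSupport (Φ ∘ f))
    (hf : ∀ x, Integrable (fracLapIntegrand s f x))
    (hi : Integrable fun x => deriv Φ (f x) * fracLap s f x) :
    0 ≤ ∫ x, deriv Φ (f x) * fracLap s f x := by
  rw [← integral_fracLap hd h0 h1 hΦf hc]
  refine integral_mono_ae (integrable_fracLap hd h0 h1 hΦf hc) hi ?_
  -- Fubini gives convergence of the singular integral of Φ ∘ f for almost every x, which is enough
  -- here.
  filter_upwards [(integrable_uncurry_fracLapIntegrand hd h0 h1 hΦf hc).prod_right_ae] with x hx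
  exact fracLap_comp_le h0 h1 hΦ (hf x) hx

end

/-! ### The nonlinear maximum principle -/

section

variable {d : ℕ} {s : ℝ}

/-- The nonlinear maximum principle: a lower bound for the fractional Laplacian at a positive
maximum, in terms of the volume of the set where the function exceeds half its maximum. -/
theorem exists_le_fracLap_of_isMax (hd : 1 ≤ d) (h0 : 0 < s) (h1 : s < 1) :
    ∃ c : ℝ, 0 < c ∧ ∀ (f : E d → ℝ) (x : E d) (V : ℝ), Measurable f → (∀ y, f y ≤ f x) →
      0 < f x → 0 < V → volume {y | f x / 2 < f y} ≤ ENNReal.ofReal V →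
      Integrable (fracLapIntegrand s f x) → c * f x * V ^ (-(2 * s / d)) ≤ fracLap s f x := by
  have hd0 : (0 : ℝ) < d := by exact_mod_cast hd
  have : Nontrivial (E d) := Module.nontrivial_of_finrank_pos (R := ℝ) (by simp; omega)
  set v : ℝ := volume.real (Metric.ball (0 : E d) 1)
  have hv : 0 < v := ENNReal.toReal_pos (Metric.measure_ball_pos _ _ one_pos).ne'
    measure_ball_lt_top.ne
  have hc := fracLapConst_pos (d := d) h0 h1
  refine ⟨fracLapConst d s / 2 * (v / 2 * (4 / v) ^ (-(2 * s / d))), by positivity, ?_⟩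
  intro f x V hfm hmax hpos hV hvol hint
  -- The ball of radius R has volume 4V. Removing the y for which x + y or x - y lies in the
  -- superlevel set costs at most V each, so volume at least 2V remains.
  set R : ℝ := (4 * V / v) ^ ((d : ℝ)⁻¹)
  have hR : 0 < R := by positivity
  have hRd : R ^ (d : ℝ) = 4 * V / v := by
    rw [← Real.rpow_mul (by positivity), inv_mul_cancel₀ hd0.ne', Real.rpow_one]
  have hball : volume (Metric.ball (0 : E d) R) = ENNReal.ofReal (4 * V) := by
    rw [Measure.addHaar_ball_of_pos _ _ hR, finrank_euclideanSpace, Fintype.card_fin,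
      ← ENNReal.ofReal_toReal (measure_ball_lt_top (μ := volume) (x := (0 : E d)) (r := 1)).ne,
      ← ENNReal.ofReal_mul (by positivity), ← Real.rpow_natCast, hRd]
    congr 1
    exact div_mul_cancel₀ _ hv.ne'
  have hSm : MeasurableSet {y | f x / 2 < f y} := measurableSet_lt measurable_const hfm
  set P : Set (E d) := (fun y => x + y) ⁻¹' {y | f x / 2 < f y}
  set N : Set (E d) := (fun y => x - y) ⁻¹' {y | f x / 2 < f y}
  have hPm : MeasurableSet P := (measurable_const_add x) hSm
  have hNm : MeasurableSet N := (measurable_const_sub x) hSm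
  have hP : volume P ≤ ENNReal.ofReal V := by
    rwa [measure_preimage_add]
  have hN : volume N ≤ ENNReal.ofReal V := by
    rwa [(Measure.measurePreserving_sub_left volume x).measure_preimage hSm.nullMeasurableSet]
  set S : Set (E d) := Metric.ball 0 R \ (P ∪ N)
  have hSmeas : MeasurableSet S := measurableSet_ball.diff (hPm.union hNm)
  have hSfin : volume S ≠ ⊤ := (measure_mono sdiff_subset |>.trans_lt measure_ball_lt_top).ne
  have hS : 2 * V ≤ volume.real S := by
    have hle : volume (Metric.ball (0 : E d) R) ≤ volume S + (volume P + volume N) :=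
      (measure_mono (fun y hy => by
        by_cases h : y ∈ P ∪ N
        exacts [Or.inr h, Or.inl ⟨hy, h⟩])).trans
        ((measure_union_le S (P ∪ N)).trans (by gcongr; exact measure_union_le _ _))
    rw [hball, ← ENNReal.ofReal_toReal hSfin] at hle
    have hle2 := hle.trans (add_le_add_right (add_le_add hP hN) _)
    rw [← ENNReal.ofReal_add hV.le hV.le, ← ENNReal.ofReal_add ENNReal.toReal_nonneg (by positivity),
      ENNReal.ofReal_le_ofReal_iff (by positivity)] at hle2
    change 2 * V ≤ (volume S).toReal
    linarith
  have hnn : ∀ y, 0 ≤ fracLapIntegrand s f x y := fun y =>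
    div_nonneg (by linarith [hmax (x + y), hmax (x - y)]) (by positivity)
  -- On S both f(x + y) and f(x - y) are at most f(x)/2, so the second difference is at least f(x).
  -- The origin is excluded because f(x) > f(x)/2.
  have hlow : ∀ y ∈ S, f x / R ^ ((d : ℝ) + 2 * s) ≤ fracLapIntegrand s f x y := by
    rintro y ⟨hyR, hy⟩
    simp only [P, N, mem_union, mem_preimage, mem_ofPred_eq, not_or, not_lt] at hy
    have hy0 : y ≠ 0 := by
      rintro rfl
      have := hy.1
      rw [add_zero] at this
      linarith
    have hyR' : ‖y‖ ≤ R := by simpa using (Metric.mem_ball.1 hyR).le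
    have : 0 < ‖y‖ := norm_pos_iff.2 hy0
    unfold fracLapIntegrand
    exact div_le_div₀ (by linarith [hy.1, hy.2]) (by linarith [hy.1, hy.2]) (by positivity)
      (by gcongr)
  have hI : 2 * V * (f x / R ^ ((d : ℝ) + 2 * s)) ≤ ∫ y, fracLapIntegrand s f x y := by
    calc 2 * V * (f x / R ^ ((d : ℝ) + 2 * s))
        ≤ volume.real S * (f x / R ^ ((d : ℝ) + 2 * s)) := by gcongr
      _ = ∫ _ in S, f x / R ^ ((d : ℝ) + 2 * s) := by rw [setIntegral_const, smul_eq_mul]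
      _ ≤ ∫ y in S, fracLapIntegrand s f x y :=
        setIntegral_mono_on (integrableOn_const hSfin) hint.integrableOn hSmeas hlow
      _ ≤ _ := setIntegral_le_integral hint (Eventually.of_forall hnn)
  have hRp : R ^ (2 * s) = (4 / v) ^ (2 * s / d) * V ^ (2 * s / d) := by
    rw [← Real.mul_rpow (by positivity) hV.le, ← Real.rpow_mul (by positivity)]
    congr 1 <;> ring
  have heq : 2 * V * (f x / R ^ ((d : ℝ) + 2 * s)) =
      v / 2 * (4 / v) ^ (-(2 * s / d)) * f x * V ^ (-(2 * s / d)) := by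
    rw [Real.rpow_add hR, hRd, hRp, Real.rpow_neg (by positivity), Real.rpow_neg hV.le]
    field_simp
    ring
  rw [heq] at hI
  unfold fracLap
  calc _ = fracLapConst d s / 2 *
        (v / 2 * (4 / v) ^ (-(2 * s / d)) * f x * V ^ (-(2 * s / d))) := by ring
    _ ≤ _ := by gcongr

/-! ### Zero mean flux of divergence-free transport -/

theorem inner_gradient_eq_sum (u : E d) (g : E d → ℝ) (x : E d) :
    inner ℝ u (gradient g x) = ∑ i, u i * fderiv ℝ g x (EuclideanSpace.single i 1) := by
  rw [inner_gradient_right, conj_trivial]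
  conv_lhs => rw [← (EuclideanSpace.basisFun (Fin d) ℝ).sum_repr u]
  simp [map_sum]

/-- A divergence free vector field transports compactly supported functions with zero mean flux. -/
theorem integral_inner_gradient_eq_zero {u : E d → E d} {g : E d → ℝ} (hu : ContDiff ℝ 1 u)
    (hdiv : ∀ x, ∑ i : Fin d, (fderiv ℝ u x (EuclideanSpace.single i 1)) i = 0)
    (hg : ContDiff ℝ 1 g) (hc : HasCompactSupport g) :
    ∫ x, inner ℝ (u x) (gradient g x) = 0 := by
  have hgd : Differentiable ℝ g := hg.differentiable one_ne_zero
  have hud : Differentiable ℝ u := hu.differentiable one_ne_zero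
  have hgc : Continuous (fderiv ℝ g) := hg.continuous_fderiv one_ne_zero
  have huc : Continuous (fderiv ℝ u) := hu.continuous_fderiv one_ne_zero
  have hui : ∀ i x, fderiv ℝ (fun x => u x i) x (EuclideanSpace.single i 1) =
      (fderiv ℝ u x (EuclideanSpace.single i 1)) i := fun i x => by
    have := ((EuclideanSpace.proj (𝕜 := ℝ) i).hasFDerivAt.comp x (hud x).hasFDerivAt).fderiv
    exact congrArg (fun L : E d →L[ℝ] ℝ => L (EuclideanSpace.single i 1)) this
  have huic : ∀ i, Continuous fun x => u x i := fun i =>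
    (EuclideanSpace.proj (𝕜 := ℝ) i).continuous.comp hu.continuous
  have hpart : ∀ i : Fin d, Continuous fun x => fderiv ℝ g x (EuclideanSpace.single i 1) :=
    fun i => hgc.clm_apply continuous_const
  have hpu : ∀ i : Fin d, Continuous fun x => (fderiv ℝ u x (EuclideanSpace.single i 1)) i :=
    fun i => (EuclideanSpace.proj (𝕜 := ℝ) i).continuous.comp (huc.clm_apply continuous_const)
  have hcs : ∀ i : Fin d, HasCompactSupport fun x => fderiv ℝ g x (EuclideanSpace.single i 1) :=
    fun i => hc.fderiv_apply ℝ _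
  have i1 : ∀ i : Fin d,
      Integrable fun x => u x i * fderiv ℝ g x (EuclideanSpace.single i 1) := fun i =>
    ((huic i).mul (hpart i)).integrable_of_hasCompactSupport (hcs i).mul_left
  have i2 : ∀ i : Fin d,
      Integrable fun x => (fderiv ℝ u x (EuclideanSpace.single i 1)) i * g x := fun i =>
    ((hpu i).mul hg.continuous).integrable_of_hasCompactSupport hc.mul_left
  simp only [fun x => inner_gradient_eq_sum (u x) g x]
  rw [integral_finsetSum _ fun i _ => i1 i]
  have hibp : ∀ i : Fin d, ∫ x, u x i * fderiv ℝ g x (EuclideanSpace.single i 1) =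
      -∫ x, (fderiv ℝ u x (EuclideanSpace.single i 1)) i * g x := fun i => by
    have h := integral_mul_fderiv_eq_neg_fderiv_mul_of_integrable (μ := (volume : Measure (E d)))
      (f := fun x => u x i) (g := g) (v := EuclideanSpace.single i 1)
      (by simpa only [hui] using i2 i) (i1 i)
      (((huic i).mul hg.continuous).integrable_of_hasCompactSupport hc.mul_left)
      (fun x _ => ((EuclideanSpace.proj (𝕜 := ℝ) i).differentiableAt.comp x (hud x)))
      (fun x _ => hgd x)
    simpa only [hui] using h
  simp only [hibp]
  rw [Finset.sum_neg_distrib, ← integral_finsetSum _ fun i _ => i2 i]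
  simp [← Finset.sum_mul, hdiv]

end

/-! ### Monotonicity of convex integrals and volume of superlevel sets -/

section

variable {d : ℕ} {α : ℝ} {u : ℝ → E d → E d} {θ : ℝ → E d → ℝ}

theorem contDiffAt_uncurry {F : Type*} [NormedAddCommGroup F] [NormedSpace ℝ F] {w : ℝ → E d → F}
    (hw : ContDiffOn ℝ ∞ (Function.uncurry w) (Ioi 0 ×ˢ univ)) {t : ℝ} (ht : 0 < t) (x : E d) :
    ContDiffAt ℝ ∞ (Function.uncurry w) (t, x) :=
  hw.contDiffAt ((isOpen_Ioi.prod isOpen_univ).mem_nhds ⟨ht, mem_univ x⟩)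

theorem contDiff_slice {F : Type*} [NormedAddCommGroup F] [NormedSpace ℝ F] {w : ℝ → E d → F}
    (hw : ContDiffOn ℝ ∞ (Function.uncurry w) (Ioi 0 ×ˢ univ)) {t : ℝ} (ht : 0 < t) :
    ContDiff ℝ ∞ (w t) :=
  contDiff_iff_contDiffAt.2 fun x =>
    (contDiffAt_uncurry hw ht x).comp x (contDiffAt_const.prodMk contDiffAt_id)

theorem hasDerivAt_time (hθ : ContDiffOn ℝ ∞ (Function.uncurry θ) (Ioi 0 ×ˢ univ)) {t : ℝ}
    (ht : 0 < t) (x : E d) :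
    HasDerivAt (fun s => θ s x) (fderiv ℝ (Function.uncurry θ) (t, x) (1, 0)) t := by
  have h1 := ((contDiffAt_uncurry hθ ht x).differentiableAt (by simp)).hasFDerivAt
  exact h1.comp_hasDerivAt (f := fun s : ℝ => (s, x)) t
    ((hasDerivAt_id t).prodMk (hasDerivAt_const t x))

theorem continuousOn_time_deriv (hθ : ContDiffOn ℝ ∞ (Function.uncurry θ) (Ioi 0 ×ˢ univ)) :
    ContinuousOn (fun p : ℝ × E d => fderiv ℝ (Function.uncurry θ) p (1, 0))
      (Ioi 0 ×ˢ univ) :=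
  (hθ.continuousOn_fderiv_of_isOpen (isOpen_Ioi.prod isOpen_univ) (by simp)).clm_apply
    continuousOn_const

theorem deriv_eq_zero_of_forall_le {Φ : ℝ → ℝ} {k : ℝ} (hΦk : ∀ s ≤ k, Φ s = 0) {s : ℝ}
    (hs : s < k) : deriv Φ s = 0 := by
  have : Φ =ᶠ[𝓝 s] fun _ => 0 := by
    filter_upwards [gt_mem_nhds hs] with r hr using hΦk r hr.le
  rw [this.deriv_eq, deriv_const]

/-- Convex functions of the solution that vanish near zero have decreasing integral. -/
theorem antitoneOn_integral_comp (hd : 1 ≤ d) (h0 : 0 < α) (h1 : α < 1)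
    (hθ : ContDiffOn ℝ ∞ (Function.uncurry θ) (Ioi 0 ×ˢ univ))
    (hu : ContDiffOn ℝ ∞ (Function.uncurry u) (Ioi 0 ×ˢ univ))
    (hdiv : DivFree u) (hsol : SolvesDriftDiffusion α u θ) (hvan : VanishesAtInfinity θ)
    {Φ : ℝ → ℝ} (hΦ : ContDiff ℝ ∞ Φ) (hconv : ∀ a b, Φ a + deriv Φ a * (b - a) ≤ Φ b)
    {k : ℝ} (hk : 0 < k) (hΦk : ∀ s ≤ k, Φ s = 0) :
    AntitoneOn (fun t => ∫ x, Φ (θ t x)) (Ioi 0) := by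
  have hΦ' : Continuous (deriv Φ) := hΦ.continuous_deriv (by simp)
  -- One ball contains the supports for all times near t, which gives the domination needed to
  -- differentiate under the integral.
  have hsupp : ∀ t : ℝ, 0 < t → ∃ R : ℝ, ∀ s ∈ Icc (t / 2) (2 * t), ∀ x : E d,
      x ∉ Metric.closedBall (0 : E d) R → θ s x < k := by
    intro t ht
    obtain ⟨R, hR⟩ := hvan (t / 2) (2 * t) (k / 2) (by linarith) (by linarith) (by linarith)
    refine ⟨R, fun s hs x hx => ?_⟩
    have := hR s hs x (by simpa using (not_le.1 (by simpa using hx)).le)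
    linarith [le_abs_self (θ s x)]
  have key : ∀ t : ℝ, 0 < t → ∃ a ≤ 0, HasDerivAt (fun t => ∫ x, Φ (θ t x)) a t := by
    intro t ht
    obtain ⟨R, hR⟩ := hsupp t ht
    have htm : t ∈ Icc (t / 2) (2 * t) := ⟨by linarith, by linarith⟩
    set D : ℝ × E d → ℝ := fun p => fderiv ℝ (Function.uncurry θ) p (1, 0)
    have hDc := continuousOn_time_deriv hθ
    have hslice : ∀ s : ℝ, 0 < s → Continuous fun x => D (s, x) := fun s hs =>
      hDc.comp_continuous (by fun_prop) fun x => ⟨hs, mem_univ _⟩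
    have hf : ContDiff ℝ ∞ (θ t) := contDiff_slice hθ ht
    have hut : ContDiff ℝ ∞ (u t) := contDiff_slice hu ht
    have hcomp : HasCompactSupport (Φ ∘ θ t) :=
      HasCompactSupport.intro (isCompact_closedBall 0 R) fun x hx =>
        hΦk _ (hR t htm x hx).le
    have hcomp' : HasCompactSupport fun x => deriv Φ (θ t x) :=
      HasCompactSupport.intro (isCompact_closedBall 0 R) fun x hx =>
        deriv_eq_zero_of_forall_le hΦk (hR t htm x hx)
    have hΦf : ContDiff ℝ ∞ (Φ ∘ θ t) := hΦ.comp hf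
    have hA : Integrable fun x => deriv Φ (θ t x) * D (t, x) :=
      ((hΦ'.comp hf.continuous).mul (hslice t ht)).integrable_of_hasCompactSupport hcomp'.mul_right
    have hBeq : ∀ x, inner ℝ (u t x) (gradient (Φ ∘ θ t) x) =
        deriv Φ (θ t x) * inner ℝ (u t x) (gradient (θ t) x) := fun x => by
      rw [inner_gradient_right, inner_gradient_right, conj_trivial, conj_trivial]
      have h := ((hΦ.differentiable (by simp)) (θ t x)).hasDerivAt.comp_hasFDerivAt x
        ((hf.differentiable (by simp)) x).hasFDerivAt
      rw [h.fderiv]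
      simp
    have hB : Integrable fun x => inner ℝ (u t x) (gradient (Φ ∘ θ t) x) := by
      have hc : Continuous fun x => inner ℝ (u t x) (gradient (Φ ∘ θ t) x) := by
        simp only [inner_gradient_right, conj_trivial]
        exact (hΦf.continuous_fderiv (by simp)).clm_apply hut.continuous
      refine hc.integrable_of_hasCompactSupport ?_
      simp only [hBeq]
      exact hcomp'.mul_right
    have hB0 := integral_inner_gradient_eq_zero (hut.of_le (by simp)) (hdiv t ht)
      (hΦf.of_le (by simp)) hcomp
    -- The equation expresses the nonlocal term through continuous, compactly supported ones; this
    -- is where its integrability comes from.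
    have hCeq : ∀ x, deriv Φ (θ t x) * fracLap α (θ t) x =
        -(deriv Φ (θ t x) * D (t, x)) - inner ℝ (u t x) (gradient (Φ ∘ θ t) x) := fun x => by
      have h := (hsol t ht x).2
      rw [(hasDerivAt_time hθ ht x).deriv] at h
      rw [hBeq x]
      linear_combination deriv Φ (θ t x) * h
    have hC : Integrable fun x => deriv Φ (θ t x) * fracLap α (θ t) x := by
      simp only [hCeq]
      exact hA.neg.sub hB
    have hC0 := integral_deriv_mul_fracLap_nonneg hd h0 h1 hconv
      (hΦf.of_le (WithTop.coe_le_coe.2 le_top)) hcomp (fun x => (hsol t ht x).1) hC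
    simp only [hCeq] at hC0
    rw [integral_sub (f := fun x => -(deriv Φ (θ t x) * D (t, x))) hA.neg hB, hB0, integral_neg, sub_zero] at hC0
    refine ⟨∫ x, deriv Φ (θ t x) * D (t, x), by linarith, ?_⟩
    have hK : IsCompact (Icc (t / 2) (2 * t) ×ˢ Metric.closedBall (0 : E d) R) :=
      isCompact_Icc.prod (isCompact_closedBall 0 R)
    have hKs : Icc (t / 2) (2 * t) ×ˢ Metric.closedBall (0 : E d) R ⊆ Ioi (0 : ℝ) ×ˢ univ :=
      fun p hp => ⟨by have := hp.1.1; simp only [mem_Ioi]; linarith, mem_univ _⟩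
    obtain ⟨C, hC⟩ := hK.exists_bound_of_continuousOn
      (f := fun p : ℝ × E d => deriv Φ (θ p.1 p.2) * D p)
      ((hΦ'.comp_continuousOn (hθ.continuousOn.mono hKs)).mul (hDc.mono hKs))
    refine (hasDerivAt_integral_of_dominated_loc_of_deriv_le
      (F := fun t x => Φ (θ t x)) (F' := fun t x => deriv Φ (θ t x) * D (t, x))
      (bound := (Metric.closedBall (0 : E d) R).indicator fun _ => C)
      (Icc_mem_nhds (by linarith : t / 2 < t) (by linarith : t < 2 * t))
      ?_ ?_ hA.aestronglyMeasurable ?_ ?_ ?_).2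
    · filter_upwards [lt_mem_nhds ht] with s hs
      exact (hΦ.continuous.comp (contDiff_slice hθ hs).continuous).aestronglyMeasurable
    · exact hΦf.continuous.integrable_of_hasCompactSupport hcomp
    · refine Eventually.of_forall fun x s hs => ?_
      by_cases hx : x ∈ Metric.closedBall (0 : E d) R
      · rw [indicator_of_mem hx]
        exact hC (s, x) ⟨hs, hx⟩
      · rw [indicator_of_notMem hx, deriv_eq_zero_of_forall_le hΦk (hR s hs x hx)]
        simp
    · exact (integrable_indicator_iff Metric.isClosed_closedBall.measurableSet).2
        (integrableOn_const measure_closedBall_lt_top.ne)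
    · refine Eventually.of_forall fun x s hs => ?_
      have hs0 : 0 < s := by have := hs.1; linarith
      exact ((hΦ.differentiable (by simp)) (θ s x)).hasDerivAt.comp s (hasDerivAt_time hθ hs0 x)
  refine antitoneOn_of_deriv_nonpos (convex_Ioi 0) (fun t ht => ?_) (fun t ht => ?_) (fun t ht => ?_)
  · obtain ⟨a, -, h⟩ := key t ht
    exact h.continuousAt.continuousWithinAt
  · rw [interior_Ioi] at ht
    obtain ⟨a, -, h⟩ := key t ht
    exact h.differentiableAt.differentiableWithinAt
  · rw [interior_Ioi] at ht
    obtain ⟨a, ha, h⟩ := key t ht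
    rwa [h.deriv]

/-- Chebyshev bound for superlevel sets, with the `L²` norm at an earlier time. -/
theorem volume_superlevel_le (hd : 1 ≤ d) (h0 : 0 < α) (h1 : α < 1)
    (hθ : ContDiffOn ℝ ∞ (Function.uncurry θ) (Ioi 0 ×ˢ univ))
    (hu : ContDiffOn ℝ ∞ (Function.uncurry u) (Ioi 0 ×ˢ univ))
    (hdiv : DivFree u) (hsol : SolvesDriftDiffusion α u θ) (hvan : VanishesAtInfinity θ)
    {s t A M : ℝ} (hs : 0 < s) (hst : s ≤ t) (hA : 0 ≤ A) (hM : 0 < M)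
    (hsA : eLpNorm (θ s) 2 volume ≤ ENNReal.ofReal A) :
    volume {x | M / 2 < θ t x} ≤ ENNReal.ofReal (16 * Real.exp 1 * (A / M) ^ 2) := by
  have ht : 0 < t := hs.trans_le hst
  -- With this k, θ > M/2 gives θ/k - 1 ≥ 1, where the cutoff is at least exp(-1). The constant 16
  -- is (M/k)².
  set k : ℝ := M / 4
  have hk : 0 < k := by positivity
  set Φ : ℝ → ℝ := fun r => convexCutoff (r / k - 1)
  have hΦ : ContDiff ℝ ∞ Φ := contDiff_convexCutoff.comp (by fun_prop)
  have hΦk : ∀ r ≤ k, Φ r = 0 := fun r hr =>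
    convexCutoff_of_nonpos (by rw [sub_nonpos, div_le_one hk]; exact hr)
  have hconv : ∀ a b, Φ a + deriv Φ a * (b - a) ≤ Φ b := fun a b => by
    have h := ((contDiff_convexCutoff.differentiable (by simp)) (a / k - 1)).hasDerivAt.comp a
      (((hasDerivAt_id a).div_const k).sub_const 1)
    have h2 : deriv Φ a = deriv convexCutoff (a / k - 1) * (1 / k) := h.deriv
    have h3 := convexCutoff_tangent_le (a / k - 1) (b / k - 1)
    rw [h2]
    refine le_trans (le_of_eq ?_) h3
    simp only [Φ]
    ring
  have hanti := antitoneOn_integral_comp hd h0 h1 hθ hu hdiv hsol hvan hΦ hconv hk hΦk hs ht hst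
  have hcs : Continuous (θ s) := (contDiff_slice hθ hs).continuous
  have hct : Continuous (θ t) := (contDiff_slice hθ ht).continuous
  have hmem : MemLp (θ s) 2 volume :=
    ⟨hcs.aestronglyMeasurable, hsA.trans_lt ENNReal.ofReal_lt_top⟩
  have hsq : Integrable (fun x => θ s x ^ 2) := hmem.integrable_sq
  have hsqA : ∫ x, θ s x ^ 2 ≤ A ^ 2 := by
    rw [hmem.eLpNorm_eq_integral_rpow_norm (by simp) (by simp), ENNReal.ofReal_le_ofReal_iff hA]
      at hsA
    simp only [ENNReal.toReal_ofNat, Real.rpow_ofNat, Real.norm_eq_abs, sq_abs] at hsA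
    rw [show (2 : ℝ)⁻¹ = 1 / 2 by norm_num, ← Real.sqrt_eq_rpow] at hsA
    exact (Real.sqrt_le_left hA).1 hsA
  have hint : ∀ r : ℝ, 0 < r → Integrable fun x => Φ (θ r x) := fun r hr => by
    obtain ⟨R, hR⟩ := hvan r r k hr le_rfl hk
    refine (hΦ.continuous.comp (contDiff_slice hθ hr).continuous).integrable_of_hasCompactSupport
      (HasCompactSupport.intro (isCompact_closedBall 0 R) fun x hx => hΦk _ ?_)
    exact (le_abs_self _).trans
      (hR r ⟨le_rfl, le_rfl⟩ x (by simpa using (not_le.1 (by simpa using hx)).le))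
  have hup : ∫ x, Φ (θ s x) ≤ (A / k) ^ 2 := by
    calc ∫ x, Φ (θ s x) ≤ ∫ x, (θ s x ^ 2) / k ^ 2 :=
          integral_mono (hint s hs) (hsq.div_const _) fun x => by
            simpa [div_pow] using convexCutoff_sub_one_le_sq (θ s x / k)
      _ = (∫ x, θ s x ^ 2) / k ^ 2 := integral_div _ _
      _ ≤ (A / k) ^ 2 := by
          rw [div_pow A k]
          exact div_le_div_of_nonneg_right hsqA (by positivity)
  have hmk := mul_meas_ge_le_integral_of_nonneg (μ := volume) (f := fun x => Φ (θ t x))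
    (Eventually.of_forall fun x => convexCutoff_nonneg _) (hint t ht) (Real.exp (-1))
  have hfin : volume {x | Real.exp (-1) ≤ Φ (θ t x)} ≠ ⊤ :=
    ((hint t ht).measure_ge_lt_top (Real.exp_pos _)).ne
  have hsub : {x | M / 2 < θ t x} ⊆ {x | Real.exp (-1) ≤ Φ (θ t x)} := fun x hx => by
    refine exp_neg_one_le_convexCutoff ?_
    have hx' : M / 2 < θ t x := hx
    rw [le_sub_iff_add_le, le_div_iff₀ hk]
    simp only [k]
    linarith
  refine (measure_mono hsub).trans ?_
  rw [← ENNReal.ofReal_toReal hfin]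
  refine ENNReal.ofReal_le_ofReal ?_
  have h2 : Real.exp (-1) * volume.real {x | Real.exp (-1) ≤ Φ (θ t x)} ≤ (A / k) ^ 2 :=
    hmk.trans (hanti.trans hup)
  have h3 := mul_le_mul_of_nonneg_left h2 (Real.exp_pos 1).le
  rw [← mul_assoc, ← Real.exp_add, add_neg_cancel, Real.exp_zero, one_mul] at h3
  refine h3.trans (le_of_eq ?_)
  simp only [k]
  field_simp
  ring

end

/-! ### The pointwise decay estimate -/

section

variable {d : ℕ} {α : ℝ}

/-- Only earlier times are compared, since the maximum over the slab may sit at its final time. -/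
theorem nonneg_of_hasDerivAt_of_forall_le_left {h : ℝ → ℝ} {h' s t : ℝ} (hst : s < t)
    (hd : HasDerivAt h h' t) (hle : ∀ r ∈ Icc s t, h r ≤ h t) : 0 ≤ h' := by
  have hs := (hasDerivAt_iff_tendsto_slope.1 hd).mono_left
    (nhdsWithin_mono t (fun r (hr : r < t) => hr.ne) : 𝓝[<] t ≤ 𝓝[≠] t)
  refine ge_of_tendsto hs ?_
  filter_upwards [Ioo_mem_nhdsLT hst] with r hr
  rw [slope_def_field]
  exact div_nonneg_of_nonpos (by linarith [hle r ⟨hr.1.le, hr.2.le⟩]) (by linarith [hr.2])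

/-- A continuous function on `[s, t] × ℝ^d` that is at most `m` outside of a bounded set and
exceeds `m` somewhere attains its maximum. -/
theorem exists_isMaxOn_slab {F : ℝ × E d → ℝ} {s t m R t₀ : ℝ} {x₀ : E d}
    (hF : ContinuousOn F (Icc s t ×ˢ univ)) (ht₀ : t₀ ∈ Icc s t)
    (hR : ∀ r ∈ Icc s t, ∀ x, R ≤ ‖x‖ → F (r, x) ≤ m) (hm : m < F (t₀, x₀)) :
    ∃ t₁ ∈ Icc s t, ∃ x₁ : E d, ∀ r ∈ Icc s t, ∀ x, F (r, x) ≤ F (t₁, x₁) := by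
  have hx₀ : x₀ ∈ Metric.closedBall (0 : E d) R := by
    by_contra h
    exact absurd hm (not_lt.2 (hR t₀ ht₀ x₀ (not_le.1 (by simpa using h)).le))
  obtain ⟨⟨t₁, x₁⟩, hp, hmax⟩ := (isCompact_Icc.prod (isCompact_closedBall 0 R)).exists_isMaxOn
    ⟨(t₀, x₀), ht₀, hx₀⟩ (hF.mono (prod_mono_right (subset_univ _)))
  refine ⟨t₁, hp.1, x₁, fun r hr x => ?_⟩
  by_cases hx : x ∈ Metric.closedBall (0 : E d) R
  · exact hmax (show (r, x) ∈ _ from ⟨hr, hx⟩)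
  · exact ((hR r hr x (not_le.1 (by simpa using hx)).le).trans hm.le).trans
      (hmax (show (t₀, x₀) ∈ _ from ⟨ht₀, hx₀⟩))

/-- Argument by contradiction at the maximum of θ (t - s)^β: the loss from diffusion, of order M
(M/A)^(1/β), cannot exceed the gain β M / (t - s) from the weight. -/
theorem exists_le_of_eLpNorm_le (hd : 1 ≤ d) (h0 : 0 < α) (h1 : α < 1) :
    ∃ C : ℝ, 0 < C ∧ ∀ (u : ℝ → E d → E d) (θ : ℝ → E d → ℝ),
      ContDiffOn ℝ ∞ (Function.uncurry θ) (Ioi 0 ×ˢ univ) →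
      ContDiffOn ℝ ∞ (Function.uncurry u) (Ioi 0 ×ˢ univ) →
      DivFree u → SolvesDriftDiffusion α u θ → VanishesAtInfinity θ →
      ∀ A s : ℝ, 0 < A → 0 < s → eLpNorm (θ s) 2 volume ≤ ENNReal.ofReal A →
      ∀ t x, s < t → θ t x ≤ C * A * (t - s) ^ (-((d : ℝ) / (4 * α))) := by
  have hd0 : (0 : ℝ) < d := by exact_mod_cast hd
  obtain ⟨c, hc, hlow⟩ := exists_le_fracLap_of_isMax hd h0 h1
  set β : ℝ := (d : ℝ) / (4 * α) with hβdef
  have hβ : 0 < β := by positivity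
  set c' : ℝ := c * (16 * Real.exp 1) ^ (-(2 * α / d))
  have hc' : 0 < c' := by positivity
  refine ⟨(β / c') ^ β, by positivity, ?_⟩
  intro u θ hθ hu hdiv hsol hvan A s hA hs hsA t₀ x₀ hst
  by_contra! hcon
  have hτ₀ : 0 < t₀ - s := sub_pos.2 hst
  -- The weight vanishes at time s, so a positive maximum occurs strictly later.
  set F : ℝ × E d → ℝ := fun p => θ p.1 p.2 * (p.1 - s) ^ β
  have hm₀ : (β / c') ^ β * A < F (t₀, x₀) := by
    rw [Real.rpow_neg hτ₀.le, ← div_eq_mul_inv, div_lt_iff₀ (by positivity)] at hcon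
    exact hcon
  have hF₀ : 0 < F (t₀, x₀) := lt_trans (by positivity) hm₀
  have hFc : ContinuousOn F (Icc s t₀ ×ˢ univ) := by
    refine ContinuousOn.mul (hθ.continuousOn.mono fun p hp => ⟨hs.trans_le hp.1.1, hp.2⟩) ?_
    exact (Continuous.rpow_const (by fun_prop) fun _ => Or.inr hβ.le).continuousOn
  obtain ⟨R, hR⟩ := hvan s t₀ (F (t₀, x₀) / 2 / (t₀ - s) ^ β) hs hst.le (by positivity)
  obtain ⟨t₁, ht₁, x₁, hmax⟩ := exists_isMaxOn_slab (x₀ := x₀) (m := F (t₀, x₀) / 2) (R := R) hFc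
    ⟨hst.le, le_rfl⟩ (fun r hr x hx => by
      have h := (le_abs_self _).trans (hR r hr x hx)
      calc F (r, x) ≤ F (t₀, x₀) / 2 / (t₀ - s) ^ β * (r - s) ^ β :=
            mul_le_mul_of_nonneg_right h (Real.rpow_nonneg (by linarith [hr.1]) _)
        _ ≤ F (t₀, x₀) / 2 / (t₀ - s) ^ β * (t₀ - s) ^ β := by
            gcongr
            · linarith [hr.1]
            · exact hr.2
        _ = _ := div_mul_cancel₀ _ (by positivity)) (by linarith)
  have hF₁ : (β / c') ^ β * A < F (t₁, x₁) := hm₀.trans_le (hmax t₀ ⟨hst.le, le_rfl⟩ x₀)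
  have hst₁ : s < t₁ := by
    refine lt_of_le_of_ne ht₁.1 ?_
    rintro rfl
    have : F (s, x₁) = 0 := by simp [F, Real.zero_rpow hβ.ne']
    rw [this] at hF₁
    exact absurd hF₁ (not_lt.2 (by positivity))
  have ht₁0 : 0 < t₁ := hs.trans hst₁
  set τ : ℝ := t₁ - s
  have hτ : 0 < τ := sub_pos.2 hst₁
  set M : ℝ := θ t₁ x₁
  have hFM : F (t₁, x₁) = M * τ ^ β := rfl
  have hM : 0 < M := by
    have : 0 < M * τ ^ β := hFM ▸ lt_trans (by positivity) hF₁
    exact pos_of_mul_pos_left this (by positivity)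
  have hmaxx : ∀ y, θ t₁ y ≤ M := fun y =>
    le_of_mul_le_mul_right (hmax t₁ ht₁ y) (by positivity : 0 < τ ^ β)
  have hgrad : inner ℝ (u t₁ x₁) (gradient (θ t₁) x₁) = 0 := by
    have : IsLocalMax (θ t₁) x₁ := Eventually.of_forall hmaxx
    rw [inner_gradient_right, this.fderiv_eq_zero]
    simp
  have hDt := hasDerivAt_time hθ ht₁0 x₁
  have heq := (hsol t₁ ht₁0 x₁).2
  rw [hDt.deriv, hgrad, add_zero] at heq
  set D : ℝ := fderiv ℝ (Function.uncurry θ) (t₁, x₁) (1, 0)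
  have hFt : HasDerivAt (fun r => F (r, x₁)) (D * τ ^ β + M * (β * τ ^ (β - 1))) t₁ := by
    have h := hDt.mul (((hasDerivAt_id t₁).sub_const s).rpow_const (p := β) (Or.inl hτ.ne'))
    refine h.congr_deriv ?_
    simp only [id]
    ring
  have hD := nonneg_of_hasDerivAt_of_forall_le_left hst₁ hFt
    fun r hr => hmax r ⟨hr.1, hr.2.trans ht₁.2⟩ x₁
  have hfl := hlow (θ t₁) x₁ (16 * Real.exp 1 * (A / M) ^ 2)
    (contDiff_slice hθ ht₁0).continuous.measurable hmaxx hM (by positivity)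
    (volume_superlevel_le hd h0 h1 hθ hu hdiv hsol hvan hs hst₁.le hA.le hM hsA)
    (hsol t₁ ht₁0 x₁).1
  -- The exponents match because 2 · 2α/d = 4α/d = 1/β.
  have hV : c * M * (16 * Real.exp 1 * (A / M) ^ 2) ^ (-(2 * α / d)) = c' * M * (M / A) ^ β⁻¹ := by
    have e1 : ((A / M) ^ 2) ^ (-(2 * α / d)) = (M / A) ^ β⁻¹ := by
      rw [← inv_div M A, inv_pow, Real.inv_rpow (by positivity), Real.rpow_neg (by positivity),
        inv_inv, ← Real.rpow_natCast, ← Real.rpow_mul (by positivity)]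
      congr 1
      rw [hβdef]
      push_cast
      field_simp
      ring
    rw [Real.mul_rpow (by positivity) (by positivity), e1]
    ring
  change c * M * _ ≤ _ at hfl
  rw [hV] at hfl
  have hτβ : τ ^ β = τ ^ (β - 1) * τ := by
    rw [← Real.rpow_add_one hτ.ne']
    congr 1
    ring
  -- Here -D equals (-Δ)^α θ at the maximum point; `hfl` bounds it below, and `hD` bounds it above
  -- by β M / τ.
  have hkey : (M / A) ^ β⁻¹ ≤ β / c' / τ := by
    rw [le_div_iff₀ hτ, le_div_iff₀ hc']
    have hp : 0 < M * τ ^ (β - 1) := by positivity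
    refine le_of_mul_le_mul_left ?_ hp
    rw [hτβ] at hD
    have : c' * M * (M / A) ^ β⁻¹ * (τ ^ (β - 1) * τ) ≤ -D * (τ ^ (β - 1) * τ) := by
      gcongr
      linarith
    linarith
  have hfin := Real.rpow_le_rpow (by positivity) hkey hβ.le
  rw [← Real.rpow_mul (by positivity), inv_mul_cancel₀ hβ.ne', Real.rpow_one,
    Real.div_rpow (by positivity) hτ.le, div_le_div_iff₀ hA (by positivity)] at hfin
  rw [hFM] at hF₁
  linarith

/-! ### Symmetry under sign change and passage to the initial time -/

theorem fracLapIntegrand_neg (s : ℝ) (f : E d → ℝ) (x : E d) :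
    fracLapIntegrand s (fun y => -f y) x = fun y => -fracLapIntegrand s f x y := by
  funext y
  simp only [fracLapIntegrand]
  ring

theorem SolvesDriftDiffusion.neg {u : ℝ → E d → E d} {θ : ℝ → E d → ℝ}
    (h : SolvesDriftDiffusion α u θ) : SolvesDriftDiffusion α u (fun t x => -θ t x) := by
  intro t ht x
  obtain ⟨hi, he⟩ := h t ht x
  refine ⟨by rw [fracLapIntegrand_neg]; exact hi.neg, ?_⟩
  have e1 : fracLap α (fun y => -θ t y) x = -fracLap α (θ t) x := by
    simp only [fracLap, fracLapIntegrand_neg, integral_neg, mul_neg]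
  have e2 : inner ℝ (u t x) (gradient (fun y => -θ t y) x) =
      -inner ℝ (u t x) (gradient (θ t) x) := by
    simp only [inner_gradient_right, conj_trivial, fderiv_fun_neg, neg_apply]
  have e3 : deriv (fun s => -θ s x) t = -deriv (fun s => θ s x) t := deriv.fun_neg
  rw [e1, e2, e3]
  linarith

theorem VanishesAtInfinity.neg {θ : ℝ → E d → ℝ} (h : VanishesAtInfinity θ) :
    VanishesAtInfinity (fun t x => -θ t x) := by
  simpa only [VanishesAtInfinity, abs_neg] using h

/-- Transfers the datum's norm to small positive times, since the decay estimate can start only at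
some s > 0. -/
theorem eventually_eLpNorm_le {θ : ℝ → E d → ℝ} (hθ : ∀ t, 0 < t → Continuous (θ t))
    (hmem : MemLp (θ 0) 2 volume) (hatt : AttainsDatumInL2 θ) {A : ℝ}
    (hA : (eLpNorm (θ 0) 2 volume).toReal < A) :
    ∀ᶠ s in 𝓝[>] (0 : ℝ), eLpNorm (θ s) 2 volume ≤ ENNReal.ofReal A := by
  have hlt : eLpNorm (θ 0) 2 volume < ENNReal.ofReal A :=
    (ENNReal.lt_ofReal_iff_toReal_lt hmem.2.ne).2 hA
  have hpos : 0 < ENNReal.ofReal A - eLpNorm (θ 0) 2 volume := tsub_pos_of_lt hlt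
  filter_upwards [hatt.eventually (gt_mem_nhds hpos), self_mem_nhdsWithin] with s hs hs0
  have hm : AEStronglyMeasurable (fun x => θ s x - θ 0 x) volume :=
    (hθ s hs0).aestronglyMeasurable.sub hmem.1
  calc eLpNorm (θ s) 2 volume = eLpNorm ((fun x => θ s x - θ 0 x) + θ 0) 2 volume := by
        congr 1
        funext x
        simp
    _ ≤ _ := eLpNorm_add_le hm hmem.1 (by norm_num)
    _ ≤ (ENNReal.ofReal A - eLpNorm (θ 0) 2 volume) + eLpNorm (θ 0) 2 volume := by gcongr
    _ = _ := tsub_add_cancel_of_le hlt.le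

end

end DriftDiffusion


theorem mainTheorem8 (d : ℕ) (hd : 1 ≤ d) (α : ℝ) (hα : α ∈ Ioo (1 / 2 : ℝ) 1) :
    ∃ C : ℝ, 0 < C ∧
      ∀ D : ℝ, 0 < D →
      ∀ θ ∈ DriftDiffusion.solutionSet d D α,
        MemLp (θ 0) 2 volume →
        DriftDiffusion.AttainsDatumInL2 θ →
        DriftDiffusion.VanishesAtInfinity θ →
        ∀ t : ℝ, 0 < t →
          eLpNorm (Function.uncurry θ) ⊤ (volume.restrict (Ici t ×ˢ univ)) ≤
            ENNReal.ofReal (C * t ^ (-((d : ℝ) / (4 * α)))) * eLpNorm (θ 0) 2 volume := by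
  have h0 : 0 < α := by linarith [hα.1]
  obtain ⟨C, hC, hbound⟩ := DriftDiffusion.exists_le_of_eLpNorm_le hd h0 hα.2
  refine ⟨C, hC, ?_⟩
  rintro D - θ ⟨hθ, -, u, q, γ, hu, hdiv, -, -, -, -, hsol⟩ hmem hatt hvan t ht
  set β : ℝ := (d : ℝ) / (4 * α)
  have hβ : 0 ≤ β := by positivity
  set N : ℝ := (eLpNorm (θ 0) 2 volume).toReal
  have hN : 0 ≤ N := ENNReal.toReal_nonneg
  have hslice : ∀ s, 0 < s → Continuous (θ s) := fun s hs =>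
    (DriftDiffusion.contDiff_slice hθ hs).continuous
  have habs : ∀ A s r x, 0 < A → 0 < s → eLpNorm (θ s) 2 volume ≤ ENNReal.ofReal A → s < r →
      |θ r x| ≤ C * A * (r - s) ^ (-β) := by
    intro A s r x hA hs hsA hsr
    refine abs_le'.2 ⟨hbound u θ hθ hu hdiv hsol hvan A s hA hs hsA r x hsr, ?_⟩
    refine hbound u (fun t x => -θ t x) hθ.neg hu hdiv hsol.neg hvan.neg A s hA hs ?_ r x hsr
    exact (eLpNorm_neg (θ s) 2 volume).trans_le hsA
  -- The strict inequality leaves room for the L² error at small s and keeps A positive even when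
  -- the datum is zero; A is sent to N afterwards.
  have hA : ∀ A, N < A → ∀ r x, 0 < r → |θ r x| ≤ C * A * r ^ (-β) := by
    intro A hNA r x hr
    have hlim : Tendsto (fun s : ℝ => C * A * (r - s) ^ (-β)) (𝓝[>] 0)
        (𝓝 (C * A * r ^ (-β))) := by
      have : ContinuousAt (fun s : ℝ => C * A * (r - s) ^ (-β)) 0 :=
        continuousAt_const.mul
          (ContinuousAt.rpow_const (by fun_prop) (Or.inl (by simpa using hr.ne')))
      simpa using this.tendsto.mono_left nhdsWithin_le_nhds
    refine ge_of_tendsto hlim ?_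
    filter_upwards [DriftDiffusion.eventually_eLpNorm_le hslice hmem hatt hNA,
      Ioo_mem_nhdsGT hr] with s hsA hs
    exact habs A s r x (hN.trans_lt hNA) hs.1 hsA hs.2
  have hfinal : ∀ r x, 0 < r → |θ r x| ≤ C * N * r ^ (-β) := by
    intro r x hr
    have hlim : Tendsto (fun A : ℝ => C * A * r ^ (-β)) (𝓝[>] N) (𝓝 (C * N * r ^ (-β))) :=
      (by fun_prop : Continuous fun A : ℝ => C * A * r ^ (-β)).continuousAt.tendsto.mono_left
        nhdsWithin_le_nhds
    refine ge_of_tendsto hlim ?_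
    filter_upwards [self_mem_nhdsWithin] with A hNA using hA A hNA r x hr
  rw [eLpNorm_exponent_top, ← ENNReal.ofReal_toReal hmem.2.ne,
    ← ENNReal.ofReal_mul (by positivity)]
  refine eLpNormEssSup_le_of_ae_bound ?_
  rw [ae_restrict_iff' (measurableSet_Ici.prod MeasurableSet.univ)]
  refine Eventually.of_forall fun p hp => ?_
  have hp1 : t ≤ p.1 := hp.1
  calc ‖Function.uncurry θ p‖ = |θ p.1 p.2| := rfl
    _ ≤ C * N * p.1 ^ (-β) := hfinal p.1 p.2 (ht.trans_le hp1)
    _ ≤ C * N * t ^ (-β) := by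
        gcongr ?_ * ?_
        exact Real.rpow_le_rpow_of_nonpos ht hp1 (by linarith)
    _ = C * t ^ (-β) * N := by ring
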